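/- Let $M\ge 2$ and let $s_1,\dots,s_M:\mathbb{R}\to\mathbb{R}$ be contracting similarities, i.e. $|s_m(x)-s_m(y)|=\rho_m|x-y|$ for all $x,y\in\mathbb{R}$, with some $\rho_m\in(0,1)$. Assume the open set condition: there is a non-empty bounded open set $O\subset\mathbb{R}$ with $\bigcup_{m} s_m(O)\subset O$ and $s_m(O)\cap s_{m'}(O)=\emptyset$ for $m\ne m'$. Let $\Gamma\subset\mathbb{R}$ be the attractor, i.e. the unique non-empty compact set with $\Gamma=\bigcup_{m=1}^M s_m(\Gamma)$, and let $\mathrm{Hull}(\Gamma)$ be its convex hull. Let $p_1,\dots,p_M\in(0,1)$ with $\sum_m p_m=1$, and let $\mu$ be a corresponding self-similar measure, i.e. a non-zero finite Borel measure supported on $\Gamma$ such that $\mu(E)=\sum_{m=1}^M p_m\,\mu(s_m^{-1}(E))$ for all Borel sets $E\subset\mathbb{R}$. Let $f$ be a real- or complex-valued function that is (real-)analytic in an open neighbourhood of $\mathrm{Hull}(\Gamma)$ in $\mathbb{R}$, and write $I[f;\mu]:=\int_\Gamma f\,\mathrm{d}\mu$. For $N\in\mathbb{N}=\{1,2,\dots\}$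 let $P_0,\dots,P_N$ be real polynomials with $\deg P_j=j$ that are mutually orthogonal with respect to $\mu$, i.e. $\int_\Gamma P_iP_j\,\mathrm{d}\mu=0$ for $i\neq j$. The $N$-point Gauss rule is $$Q^{\mathrm G}_N[f;\mu]:=\sum_{j=1}^N w_j f(x_j),\qquad w_j:=\int_\Gamma \ell_j\,\mathrm{d}\mu,$$ where $x_1,\dots,x_N$ are the zeros of $P_N$ and $\ell_j$ is the Lagrange basis polynomial of degree $N-1$ with $\ell_j(x_i)=\delta_{ij}$. Then the integral and the Gauss rules are well defined: $f$ is $\mu$-integrable on $\Gamma$ and, for every $N\in\mathbb{N}$, such polynomials $P_0,\dots,P_N$ exist, and for any choice of them $P_N$ has exactly $N$ distinct real zeros, all lying in $\mathrm{Hull}(\Gamma)$. Moreover, there are constants $C>0$ and $c>0$, independent of $N$ (and of the choice of the orthogonal polynomials), such that $$\left|I[f;\mu]-Q^{\mathrm G}_N[f;\mu]\right|\le C\,\mathrm{e}^{-cN}\qquad\text{for all } N\in\mathbb{N}.$$ -/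

import Mathlib

open MeasureTheory Polynomial

/-- An iterated function system of `M ≥ 2` contracting similarities of the real line. -/
structure SimilarityIFS (M : ℕ) where
  two_le : 2 ≤ M
  /-- the maps `s₁, …, s_M` -/
  map : Fin M → ℝ → ℝ
  /-- the contraction factors `ρ₁, …, ρ_M` -/
  ratio : Fin M → ℝ
  ratio_pos : ∀ m, 0 < ratio m
  ratio_lt_one : ∀ m, ratio m < 1
  abs_map_sub_map : ∀ m x y, |map m x - map m y| = ratio m * |x - y|

/-- The open set condition. -/
def SimilarityIFS.OpenSetCondition {M : ℕ} (S : SimilarityIFS M) : Prop :=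
  ∃ O : Set ℝ, O.Nonempty ∧ Bornology.IsBounded O ∧ IsOpen O ∧
    (⋃ m, S.map m '' O) ⊆ O ∧
    ∀ m m', m ≠ m' → Disjoint (S.map m '' O) (S.map m' '' O)

/-- `Γ` is the attractor of the IFS, i.e. the (necessarily unique) non-empty compact set
that is the union of its images under the maps of the IFS. -/
structure SimilarityIFS.IsAttractor {M : ℕ} (S : SimilarityIFS M) (Γ : Set ℝ) : Prop where
  nonempty : Γ.Nonempty
  isCompact : IsCompact Γ
  eq_iUnion : Γ = ⋃ m, S.map m '' Γ

/-- `μ` is a self-similar measure on `Γ` with weights `p₁, …, p_M`: a positive (that is, non-zero)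
finite Borel measure supported on `Γ`, not necessarily normalised, such that
`μ(E) = ∑ₘ pₘ μ(sₘ⁻¹(E))` for all measurable `E`. -/
structure SimilarityIFS.IsSelfSimilarMeasure {M : ℕ} (S : SimilarityIFS M) (Γ : Set ℝ)
    (p : Fin M → ℝ) (μ : Measure ℝ) : Prop where
  weight_pos : ∀ m, 0 < p m
  weight_lt_one : ∀ m, p m < 1
  sum_weight : ∑ m, p m = 1
  finite : IsFiniteMeasure μ
  ne_zero : μ ≠ 0
  supported : μ Γᶜ = 0
  self_similar : ∀ E : Set ℝ, MeasurableSet E →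
    μ E = ∑ m, ENNReal.ofReal (p m) * μ (S.map m ⁻¹' E)

/-- `P₀, …, P_N` are real polynomials, `P_j` of exact degree `j`, that are mutually orthogonal
with respect to `μ` on `Γ`. No normalisation is imposed. -/
structure IsOrthogonalPolynomials (Γ : Set ℝ) (μ : Measure ℝ) (N : ℕ)
    (P : Fin (N + 1) → ℝ[X]) : Prop where
  degree_eq : ∀ j, (P j).degree = ((j : ℕ) : WithBot ℕ)
  orthogonal : ∀ i j, i ≠ j → ∫ x in Γ, (P i).eval x * (P j).eval x ∂μ = 0

/-- The set of nodes given by a polynomial `q`: its distinct real zeros. -/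
noncomputable def quadNodes (q : ℝ[X]) : Finset ℝ := q.roots.toFinset

/-- The weight at the node `x`: the integral of the Lagrange basis polynomial which is `1` at `x`
and `0` at the other nodes. -/
noncomputable def quadWeight (Γ : Set ℝ) (μ : Measure ℝ) (q : ℝ[X]) (x : ℝ) : ℝ :=
  ∫ t in Γ, (Lagrange.basis (quadNodes q) id x).eval t ∂μ

/-- The `N`-point Gauss rule `∑ⱼ wⱼ f(xⱼ)` for orthogonal polynomials `P₀, …, P_N`; its nodes are
the zeros of `P_N`. -/
noncomputable def gaussRule {𝕜 : Type*} [RCLike 𝕜] (Γ : Set ℝ) (μ : Measure ℝ) (N : ℕ)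
    (P : Fin (N + 1) → ℝ[X]) (f : ℝ → 𝕜) : 𝕜 :=
  ∑ x ∈ quadNodes (P (Fin.last N)), quadWeight Γ μ (P (Fin.last N)) x • f x

/-! ### Exponential approximation of analytic functions by polynomials -/

/-! The Gauss rule is exact in degree below `2 * N`, has non-negative weights summing to `μ(Γ)`, and
has its nodes in the hull. Its error is therefore at most `2 μ(Γ)` times the uniform distance on the
hull from `f` to such polynomials (`abs_integral_sub_gaussRule_le`), and two facts remain.

Approximation: that distance decays geometrically for real-analytic `f`. The argument stays on the
real line: local Taylor polynomials are glued with the Bernstein basis as a partition of unity, and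
the Chernoff tail of the binomial law beats their geometric growth away from their centres
(`exists_polynomial_approx_unit`).

Non-degeneracy: Gauss theory needs `μ` not to live on a finite set. Otherwise its atoms would form a
finite set permuted by every contraction, hence a single common fixed point, which the open set
condition forbids (`measure_compl_finset_ne_zero`). -/

/-- The left side is the moment generating function of a centred binomial variable, so it is an
`n`-th power. In `exp u ≤ 1 + u + u ^ 2` the linear terms cancel by centring. -/
theorem sum_bernsteinPolynomial_mul_exp_le (n : ℕ) {t : ℝ} (ht : t ∈ Set.Icc (0 : ℝ) 1) {l : ℝ}
    (hl : |l| ≤ 1) :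
    ∑ k ∈ Finset.range (n + 1), (bernsteinPolynomial ℝ n k).eval t * Real.exp (l * (k - n * t)) ≤
      Real.exp (n * l ^ 2) := by
  obtain ⟨h0, h1⟩ := ht
  have hl2 := abs_le.1 hl
  have key : ∑ k ∈ Finset.range (n + 1),
      (bernsteinPolynomial ℝ n k).eval t * Real.exp (l * (k - n * t)) =
      (t * Real.exp (l * (1 - t)) + (1 - t) * Real.exp (-(l * t))) ^ n := by
    rw [add_pow]
    refine Finset.sum_congr rfl fun k hk => ?_
    have hk' : k ≤ n := Nat.lt_succ_iff.1 (Finset.mem_range.1 hk)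
    have : Real.exp (l * (k - n * t)) =
        Real.exp (l * (1 - t)) ^ k * Real.exp (-(l * t)) ^ (n - k) := by
      rw [← Real.exp_nat_mul, ← Real.exp_nat_mul, ← Real.exp_add, Nat.cast_sub hk']
      congr 1; ring
    rw [this]
    simp only [bernsteinPolynomial, eval_mul, eval_pow, eval_X, eval_sub, eval_one, eval_natCast,
      mul_pow]
    ring
  have e1 : Real.exp (l * (1 - t)) ≤ 1 + l * (1 - t) + (l * (1 - t)) ^ 2 := by
    have := (abs_le.1 (Real.abs_exp_sub_one_sub_id_le (x := l * (1 - t)) (by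
      rw [abs_mul, abs_of_nonneg (by linarith : 0 ≤ 1 - t)]
      nlinarith [abs_nonneg l]))).2
    linarith
  have e2 : Real.exp (-(l * t)) ≤ 1 - l * t + (l * t) ^ 2 := by
    have := (abs_le.1 (Real.abs_exp_sub_one_sub_id_le (x := -(l * t)) (by
      rw [abs_neg, abs_mul, abs_of_nonneg h0]
      nlinarith [abs_nonneg l]))).2
    nlinarith
  rw [key, Real.exp_nat_mul]
  refine pow_le_pow_left₀ (by have := sub_nonneg.2 h1; positivity) ?_ n
  calc _ ≤ t * (1 + l * (1 - t) + (l * (1 - t)) ^ 2) + (1 - t) * (1 - l * t + (l * t) ^ 2) :=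
        add_le_add (mul_le_mul_of_nonneg_left e1 h0)
          (mul_le_mul_of_nonneg_left e2 (sub_nonneg.2 h1))
    _ = l ^ 2 * (t * (1 - t)) + 1 := by ring
    _ ≤ l ^ 2 + 1 := by
        have : t * (1 - t) ≤ 1 := by nlinarith
        nlinarith [sq_nonneg l]
    _ ≤ _ := Real.add_one_le_exp _

theorem bernsteinPolynomial_eval_nonneg (n k : ℕ) {t : ℝ} (ht : t ∈ Set.Icc (0 : ℝ) 1) :
    0 ≤ (bernsteinPolynomial ℝ n k).eval t := by
  have := sub_nonneg.2 ht.2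
  have := ht.1
  simp only [bernsteinPolynomial, eval_mul, eval_pow, eval_X, eval_sub, eval_one, eval_natCast]
  positivity

/-- A Chernoff bound for the binomial distribution. -/
theorem sum_bernsteinPolynomial_tail_le (n : ℕ) {t : ℝ} (ht : t ∈ Set.Icc (0 : ℝ) 1) {d : ℝ}
    (hd : 0 ≤ d) (hd1 : d ≤ 1) :
    ∑ k ∈ (Finset.range (n + 1)).filter (fun k : ℕ => n * d ≤ |(k : ℝ) - n * t|),
      (bernsteinPolynomial ℝ n k).eval t ≤ 2 * Real.exp (-(n * (d ^ 2 / 4))) := by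
  -- Tilting by `±d / 2` treats both tails at once; the exponent is `-d ^ 2 / 2 + d ^ 2 / 4`.
  have hl : |d / 2| ≤ 1 := by rw [abs_le]; constructor <;> linarith
  have hl' : |-(d / 2)| ≤ 1 := by rwa [abs_neg]
  have s1 := sum_bernsteinPolynomial_mul_exp_le n ht hl
  have s2 := sum_bernsteinPolynomial_mul_exp_le n ht hl'
  have bd : ∀ k ∈ Finset.range (n + 1), 0 ≤ (bernsteinPolynomial ℝ n k).eval t *
      (Real.exp (d / 2 * (k - n * t)) + Real.exp (-(d / 2) * (k - n * t))) := fun k _ =>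
    mul_nonneg (bernsteinPolynomial_eval_nonneg n k ht) (by positivity)
  calc _ ≤ ∑ k ∈ (Finset.range (n + 1)).filter (fun k : ℕ => n * d ≤ |(k : ℝ) - n * t|),
        Real.exp (-(n * (d ^ 2 / 2))) * ((bernsteinPolynomial ℝ n k).eval t *
        (Real.exp (d / 2 * (k - n * t)) + Real.exp (-(d / 2) * (k - n * t)))) := by
        refine Finset.sum_le_sum fun k hk => ?_
        have hk2 := (Finset.mem_filter.1 hk).2
        have h1 : Real.exp (d / 2 * (n * d)) ≤
            Real.exp (d / 2 * (k - n * t)) + Real.exp (-(d / 2) * (k - n * t)) := by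
          rcases le_abs.1 hk2 with h | h
          · exact (Real.exp_le_exp.2 (mul_le_mul_of_nonneg_left h (by linarith))).trans
              (le_add_of_nonneg_right (Real.exp_pos _).le)
          · refine (Real.exp_le_exp.2 ?_).trans (le_add_of_nonneg_left (Real.exp_pos _).le)
            nlinarith
        have h2 : Real.exp (-(n * (d ^ 2 / 2))) * Real.exp (d / 2 * (n * d)) = 1 := by
          rw [← Real.exp_add, ← Real.exp_zero]; congr 1; ring
        have hB := bernsteinPolynomial_eval_nonneg n k ht
        calc _ = (bernsteinPolynomial ℝ n k).eval t *
              (Real.exp (-(n * (d ^ 2 / 2))) * Real.exp (d / 2 * (n * d))) := by rw [h2, mul_one]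
          _ ≤ (bernsteinPolynomial ℝ n k).eval t * (Real.exp (-(n * (d ^ 2 / 2))) *
              (Real.exp (d / 2 * (k - n * t)) + Real.exp (-(d / 2) * (k - n * t)))) := by gcongr
          _ = _ := by ring
    _ ≤ Real.exp (-(n * (d ^ 2 / 2))) * ∑ k ∈ Finset.range (n + 1),
        (bernsteinPolynomial ℝ n k).eval t *
        (Real.exp (d / 2 * (k - n * t)) + Real.exp (-(d / 2) * (k - n * t))) := by
        rw [← Finset.mul_sum]
        exact mul_le_mul_of_nonneg_left (Finset.sum_le_sum_of_subset_of_nonneg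
          (Finset.filter_subset _ _) fun k hk _ => bd k hk) (Real.exp_pos _).le
    _ ≤ Real.exp (-(n * (d ^ 2 / 2))) *
        (Real.exp (n * (d / 2) ^ 2) + Real.exp (n * (-(d / 2)) ^ 2)) := by
        gcongr
        simp only [mul_add, Finset.sum_add_distrib]
        exact add_le_add s1 s2
    _ = _ := by
        have : Real.exp (-(n * (d ^ 2 / 4))) =
            Real.exp (-(n * (d ^ 2 / 2))) * Real.exp (n * (d / 2) ^ 2) := by
          rw [← Real.exp_add]; congr 1; ring
        rw [this, neg_sq]; ring

/-- The function `f` has, around each point of `s` and in each degree `m`, a polynomial approximant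
which is close to `f` on a neighbourhood of uniform size within `[0, 1]` and which grows at most
geometrically in `m` on the whole of `[0, 1]`. -/
def HasLocalApprox (f : ℝ → ℝ) (s : Set ℝ) : Prop :=
  ∃ δ C B : ℝ, 0 < δ ∧ 0 ≤ C ∧ 1 ≤ B ∧ ∀ y ∈ s, ∀ m : ℕ, ∃ T : ℝ[X], T.natDegree ≤ m ∧
    (∀ x ∈ Set.Icc (0 : ℝ) 1, |T.eval x| ≤ C * B ^ m) ∧
    ∀ x ∈ Set.Icc (0 : ℝ) 1, |x - y| < δ → |f x - T.eval x| ≤ C * (1 / 2) ^ m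

theorem HasLocalApprox.mono {f : ℝ → ℝ} {s t : Set ℝ} (hst : s ⊆ t) (h : HasLocalApprox f t) :
    HasLocalApprox f s := by
  obtain ⟨δ, C, B, hδ, hC, hB, H⟩ := h
  exact ⟨δ, C, B, hδ, hC, hB, fun y hy => H y (hst hy)⟩

/-- Stability under unions is what lets compactness turn the pointwise statement into a uniform one.
-/
theorem HasLocalApprox.union {f : ℝ → ℝ} {s t : Set ℝ} (hs : HasLocalApprox f s)
    (ht : HasLocalApprox f t) : HasLocalApprox f (s ∪ t) := by
  obtain ⟨δ, C, B, hδ, hC, hB, H⟩ := hs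
  obtain ⟨δ', C', B', hδ', hC', hB', H'⟩ := ht
  have hB0 : 0 ≤ B := by linarith
  have hB0' : 0 ≤ B' := by linarith
  refine ⟨min δ δ', max C C', max B B', lt_min hδ hδ', le_max_of_le_left hC,
    le_max_of_le_left hB, fun y hy m => ?_⟩
  rcases hy with hy | hy
  · obtain ⟨T, h1, h2, h3⟩ := H y hy m
    exact ⟨T, h1, fun x hx => (h2 x hx).trans (by gcongr <;> exact le_max_left _ _),
      fun x hx hxy => (h3 x hx (hxy.trans_le (min_le_left _ _))).trans
        (by gcongr; exact le_max_left _ _)⟩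
  · obtain ⟨T, h1, h2, h3⟩ := H' y hy m
    exact ⟨T, h1, fun x hx => (h2 x hx).trans (by gcongr <;> exact le_max_right _ _),
      fun x hx hxy => (h3 x hx (hxy.trans_le (min_le_right _ _))).trans
        (by gcongr; exact le_max_right _ _)⟩

theorem AnalyticAt.hasLocalApprox {f : ℝ → ℝ} {y₀ : ℝ} (hf : AnalyticAt ℝ f y₀) :
    ∃ r > 0, HasLocalApprox f (Metric.ball y₀ r) := by
  obtain ⟨p, r, hp⟩ := hf
  obtain ⟨r', hr0, hr'⟩ := ENNReal.lt_iff_exists_nnreal_btwn.1 hp.r_pos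
  have hr0' : (0 : ℝ) < r' := by exact_mod_cast ENNReal.coe_pos.1 hr0
  obtain ⟨a, ha, C, hC, H⟩ := hp.uniform_geometric_approx' hr'
  obtain ⟨C', R, hC', hR, H'⟩ := p.le_mul_pow_of_radius_pos hp.radius_pos
  set L : ℝ := 1 + |y₀| with hL
  set D : ℝ := max 1 (R * L) with hD
  have hD1 : 1 ≤ D := le_max_left _ _
  have hL0 : 0 ≤ L := by positivity
  -- All points of the ball share the Taylor polynomials at `y₀`. The two radii `r' / 4` add up to
  -- `|x - y₀| < r' / 2`, whence the rate `1 / 2`. In `2 * D`, the `2` absorbs the number `m` of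
  -- terms.
  refine ⟨r' / 4, by positivity, r' / 4, max C C', 2 * D, by positivity, le_max_of_le_left hC.le,
    by linarith, fun y hy m => ?_⟩
  have hT : ∀ x, (∑ k ∈ Finset.range m, Polynomial.C (p.coeff k) * (X - Polynomial.C y₀) ^ k).eval x
      = p.partialSum m (x - y₀) := by
    intro x
    simp only [FormalMultilinearSeries.partialSum, eval_finsetSum, eval_mul, eval_C, eval_pow,
      eval_sub, eval_X, FormalMultilinearSeries.apply_eq_pow_smul_coeff, smul_eq_mul]
    exact Finset.sum_congr rfl fun k _ => mul_comm _ _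
  refine ⟨∑ k ∈ Finset.range m, Polynomial.C (p.coeff k) * (X - Polynomial.C y₀) ^ k, ?_, ?_, ?_⟩
  · refine natDegree_sum_le_of_forall_le _ _ fun k hk => ?_
    refine (natDegree_C_mul_le _ _).trans ?_
    rw [natDegree_pow, natDegree_X_sub_C, mul_one]
    exact (Finset.mem_range.1 hk).le
  · intro x hx
    have hxL : |x - y₀| ≤ L := by
      have : |x| ≤ 1 := abs_le.2 ⟨by linarith [hx.1], hx.2⟩
      exact (abs_sub x y₀).trans (by linarith)
    simp only [eval_finsetSum, eval_mul, eval_C, eval_pow, eval_sub, eval_X]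
    calc _ ≤ ∑ k ∈ Finset.range m, |p.coeff k * (x - y₀) ^ k| := Finset.abs_sum_le_sum_abs _ _
      _ ≤ ∑ k ∈ Finset.range m, C' * D ^ m := by
          refine Finset.sum_le_sum fun k hk => ?_
          rw [abs_mul, abs_pow]
          have hc : |p.coeff k| ≤ C' * R ^ k := by
            have := H' k
            rwa [FormalMultilinearSeries.norm_apply_eq_norm_coef, Real.norm_eq_abs] at this
          calc _ ≤ C' * R ^ k * L ^ k := by gcongr
            _ = C' * (R * L) ^ k := by rw [mul_pow]; ring
            _ ≤ C' * D ^ k := by gcongr; exact le_max_right _ _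
            _ ≤ C' * D ^ m := by gcongr; exact (Finset.mem_range.1 hk).le
      _ = C' * (m * D ^ m) := by rw [Finset.sum_const, Finset.card_range, nsmul_eq_mul]; ring
      _ ≤ max C C' * (2 ^ m * D ^ m) := by
          gcongr
          · exact le_max_right _ _
          · exact_mod_cast Nat.lt_two_pow_self.le
      _ = _ := by rw [mul_pow]
  · intro x hx hxy
    rw [hT]
    have hxy0 : |x - y₀| < r' / 2 := by
      have := Metric.mem_ball.1 hy
      rw [Real.dist_eq] at this
      calc |x - y₀| ≤ |x - y| + |y - y₀| := abs_sub_le _ _ _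
        _ < r' / 2 := by linarith
    have := H (x - y₀) (by rw [mem_ball_zero_iff, Real.norm_eq_abs]; linarith) m
    rw [add_sub_cancel, Real.norm_eq_abs, Real.norm_eq_abs] at this
    refine this.trans ?_
    have ha0 := ha.1.le
    gcongr
    · exact le_max_left _ _
    · have : |x - y₀| / r' ≤ 1 / 2 := by rw [div_le_iff₀ hr0']; linarith
      have h0 : 0 ≤ |x - y₀| / r' := by positivity
      nlinarith [ha.2]

theorem AnalyticOnNhd.hasLocalApprox {f : ℝ → ℝ} {s : Set ℝ} (hs : IsCompact s)
    (hf : AnalyticOnNhd ℝ f s) : HasLocalApprox f s := by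
  refine hs.induction_on ⟨1, 0, 1, one_pos, le_rfl, le_rfl, by simp⟩
    (fun _ _ h H => H.mono h) (fun _ _ h h' => h.union h') fun y hy => ?_
  obtain ⟨r, hr, H⟩ := (hf y hy).hasLocalApprox
  exact ⟨_, mem_nhdsWithin_of_mem_nhds (Metric.ball_mem_nhds y hr), H⟩

theorem natDegree_bernsteinPolynomial_le {n k : ℕ} (h : k ≤ n) :
    (bernsteinPolynomial ℝ n k).natDegree ≤ n := by
  unfold bernsteinPolynomial
  compute_degree
  omega

/-- An analytic function on `[0, 1]` is the limit of polynomials at a geometric rate. The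
approximants are obtained from Bernstein's by replacing the values of `f` with local Taylor
polynomials. -/
theorem AnalyticOnNhd.exists_polynomial_approx_unit {f : ℝ → ℝ}
    (hf : AnalyticOnNhd ℝ f (Set.Icc 0 1)) :
    ∃ (A : ℝ) (K : ℕ), 0 ≤ A ∧ ∀ m : ℕ, ∃ q : ℝ[X], q.natDegree ≤ (K + 1) * m ∧
      ∀ x ∈ Set.Icc (0 : ℝ) 1, |f x - q.eval x| ≤ A * (1 / 2) ^ m := by
  obtain ⟨δ₀, C, B, hδ₀, hC, hB, H⟩ := hf.hasLocalApprox isCompact_Icc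
  set δ := min δ₀ 1 with hδdef
  have hδ : 0 < δ := lt_min hδ₀ one_pos
  have hδ1 : δ ≤ 1 := min_le_right _ _
  have hB0 : 0 < B := by linarith
  obtain ⟨F, hF⟩ : ∃ F, ∀ x ∈ Set.Icc (0 : ℝ) 1, |f x| ≤ F := by
    obtain ⟨F, hF⟩ := isCompact_Icc.exists_bound_of_continuousOn hf.continuousOn
    exact ⟨F, fun x hx => hF x hx⟩
  have hF0 : 0 ≤ F := (abs_nonneg _).trans (hF 0 (by simp))
  -- With Bernstein degree `K * m`, the tail then beats the growth `B ^ m` by a factor `(1 / 2) ^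
  -- m`.
  obtain ⟨K, hK⟩ : ∃ K : ℕ, B * Real.exp (-(K * (δ ^ 2 / 4))) ≤ 1 / 2 := by
    obtain ⟨K, hK⟩ := exists_nat_ge (2 * B / (δ ^ 2 / 4))
    refine ⟨K, ?_⟩
    rw [div_le_iff₀ (by positivity)] at hK
    have h2 : 2 * B ≤ Real.exp (K * (δ ^ 2 / 4)) := by
      linarith [Real.add_one_le_exp ((K : ℝ) * (δ ^ 2 / 4))]
    rw [Real.exp_neg, ← div_eq_mul_inv, div_le_iff₀ (Real.exp_pos _)]
    linarith
  refine ⟨C + (F + C) * 2, K, by positivity, fun m => ?_⟩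
  -- If `K * m = 0`, the only grid point is `0 / 0 = 0`, still in the interval.
  have hgrid : ∀ k ∈ Finset.range (K * m + 1),
      ((k : ℝ) / ((K * m : ℕ) : ℝ)) ∈ Set.Icc (0 : ℝ) 1 := fun k hk =>
    ⟨by positivity, div_le_one_of_le₀
      (by exact_mod_cast Nat.lt_succ_iff.1 (Finset.mem_range.1 hk)) (by positivity)⟩
  choose! T hT1 hT2 hT3 using fun y hy => H y hy m
  set n := K * m with hn
  refine ⟨∑ k ∈ Finset.range (n + 1), bernsteinPolynomial ℝ n k * T ((k : ℝ) / (n : ℝ)), ?_, ?_⟩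
  · refine natDegree_sum_le_of_forall_le _ _ fun k hk => natDegree_mul_le.trans ?_
    rw [add_mul, one_mul]
    exact add_le_add
      (natDegree_bernsteinPolynomial_le (Nat.lt_succ_iff.1 (Finset.mem_range.1 hk)))
      (hT1 _ (hgrid k hk))
  · intro x hx
    have hone : ∑ k ∈ Finset.range (n + 1), (bernsteinPolynomial ℝ n k).eval x = 1 := by
      rw [← eval_finsetSum, bernsteinPolynomial.sum, eval_one]
    have hdiff : f x - (∑ k ∈ Finset.range (n + 1),
        bernsteinPolynomial ℝ n k * T ((k : ℝ) / (n : ℝ))).eval x =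
        ∑ k ∈ Finset.range (n + 1), (bernsteinPolynomial ℝ n k).eval x *
          (f x - (T ((k : ℝ) / (n : ℝ))).eval x) := by
      simp only [mul_sub, Finset.sum_sub_distrib, ← Finset.sum_mul, hone, one_mul,
        eval_finsetSum, eval_mul]
    have hb : ∀ k, 0 ≤ (bernsteinPolynomial ℝ n k).eval x :=
      fun k => bernsteinPolynomial_eval_nonneg n k hx
    rw [hdiff]
    calc _ ≤ ∑ k ∈ Finset.range (n + 1), (bernsteinPolynomial ℝ n k).eval x *
          |f x - (T ((k : ℝ) / (n : ℝ))).eval x| := by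
          refine (Finset.abs_sum_le_sum_abs _ _).trans (Finset.sum_le_sum fun k _ => ?_)
          rw [abs_mul, abs_of_nonneg (hb k)]
      _ ≤ ∑ k ∈ Finset.range (n + 1), ((bernsteinPolynomial ℝ n k).eval x * (C * (1 / 2) ^ m) +
          if n * δ ≤ |(k : ℝ) - n * x| then
            (bernsteinPolynomial ℝ n k).eval x * ((F + C) * B ^ m) else 0) := by
          refine Finset.sum_le_sum fun k hk => ?_
          have hbk := hb k
          split_ifs with hfar
          · refine le_add_of_nonneg_of_le (by positivity) (mul_le_mul_of_nonneg_left ?_ hbk)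
            calc _ ≤ |f x| + |(T ((k : ℝ) / (n : ℝ))).eval x| := abs_sub _ _
              _ ≤ F * 1 + C * B ^ m := by
                  rw [mul_one]; exact add_le_add (hF x hx) (hT2 _ (hgrid k hk) x hx)
              _ ≤ F * B ^ m + C * B ^ m := by gcongr; exact one_le_pow₀ hB
              _ = _ := by ring
          · rw [add_zero]
            refine mul_le_mul_of_nonneg_left (hT3 _ (hgrid k hk) x hx ?_) hbk
            rw [not_le] at hfar
            -- For `n = 0` every index counts as far, so a near index forces `n > 0`.
            have hn0 : (0 : ℝ) < n := by
              have := (abs_nonneg _).trans_lt hfar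
              exact pos_of_mul_pos_left this hδ.le
            have : x - k / n = -((k - n * x) / n) := by field_simp; ring
            rw [this, abs_neg, abs_div, abs_of_pos hn0, div_lt_iff₀ hn0]
            exact hfar.trans_le (by
              rw [mul_comm]; exact mul_le_mul_of_nonneg_right (min_le_left _ _) hn0.le)
      _ = C * (1 / 2) ^ m + (∑ k ∈ (Finset.range (n + 1)).filter (fun k : ℕ => n * δ ≤ |(k : ℝ) - n * x|),
            (bernsteinPolynomial ℝ n k).eval x) * ((F + C) * B ^ m) := by
          rw [Finset.sum_add_distrib, ← Finset.sum_mul, hone, one_mul, Finset.sum_mul,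
            Finset.sum_filter]
      _ ≤ C * (1 / 2) ^ m + (2 * Real.exp (-(n * (δ ^ 2 / 4)))) * ((F + C) * B ^ m) := by
          gcongr
          exact sum_bernsteinPolynomial_tail_le n hx hδ.le hδ1
      _ = C * (1 / 2) ^ m + (F + C) * 2 * (B * Real.exp (-(K * (δ ^ 2 / 4)))) ^ m := by
          have : Real.exp (-(n * (δ ^ 2 / 4))) = Real.exp (-(K * (δ ^ 2 / 4))) ^ m := by
            rw [← Real.exp_nat_mul, hn]; congr 1; push_cast; ring
          rw [this, mul_pow]; ring
      _ ≤ C * (1 / 2) ^ m + (F + C) * 2 * (1 / 2) ^ m := by gcongr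
      _ = _ := by ring

theorem AnalyticOnNhd.exists_polynomial_approx {f : ℝ → ℝ} {a b : ℝ}
    (hf : AnalyticOnNhd ℝ f (Set.Icc a b)) :
    ∃ (A : ℝ) (K : ℕ), 0 ≤ A ∧ ∀ m : ℕ, ∃ q : ℝ[X], q.natDegree ≤ (K + 1) * m ∧
      ∀ x ∈ Set.Icc a b, |f x - q.eval x| ≤ A * (1 / 2) ^ m := by
  rcases le_or_gt b a with hab | hab
  · refine ⟨0, 0, le_rfl, fun m => ⟨C (f a), by simp, fun x hx => ?_⟩⟩
    obtain rfl : x = a := le_antisymm (hx.2.trans hab) hx.1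
    simp
  have hL : 0 < b - a := sub_pos.2 hab
  have hmap : Set.MapsTo (fun t => a + (b - a) * t) (Set.Icc 0 1) (Set.Icc a b) :=
    fun t ht => ⟨by nlinarith [ht.1], by nlinarith [ht.2]⟩
  have hg : AnalyticOnNhd ℝ (f ∘ fun t => a + (b - a) * t) (Set.Icc 0 1) :=
    hf.comp (fun t _ => by fun_prop) hmap
  obtain ⟨A, K, hA, H⟩ := hg.exists_polynomial_approx_unit
  refine ⟨A, K, hA, fun m => ?_⟩
  obtain ⟨q, hq, hfq⟩ := H m
  refine ⟨q.comp (C (b - a)⁻¹ * (X - C a)), ?_, fun x hx => ?_⟩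
  · refine natDegree_comp_le.trans ?_
    have : (C (b - a)⁻¹ * (X - C a)).natDegree ≤ 1 := by compute_degree
    exact (Nat.mul_le_mul hq this).trans (mul_one _).le
  · have h := hfq ((b - a)⁻¹ * (x - a)) ⟨mul_nonneg (inv_nonneg.2 hL.le) (sub_nonneg.2 hx.1), by
      rw [inv_mul_le_iff₀ hL]; linarith [hx.2]⟩
    have hx' : a + (b - a) * ((b - a)⁻¹ * (x - a)) = x := by field_simp; ring
    simpa [hx'] using h

/-! ### Gauss quadrature with respect to a finite measure on a compact set -/

section Quadrature

/-- No non-zero polynomial vanishes `μ`-almost everywhere on `Γ`; equivalently, `μ` restricted to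
`Γ` is not concentrated on a finite set. -/
def PolynomialDetermining (Γ : Set ℝ) (μ : Measure ℝ) : Prop :=
  ∀ q : ℝ[X], (∀ᵐ x ∂μ.restrict Γ, q.eval x = 0) → q = 0

variable {Γ : Set ℝ} {μ : Measure ℝ} {N : ℕ} {P : Fin (N + 1) → ℝ[X]}

theorem IsOrthogonalPolynomials.natDegree_last (hP : IsOrthogonalPolynomials Γ μ N P) :
    (P (Fin.last N)).natDegree = N :=
  natDegree_eq_of_degree_eq_some (hP.degree_eq _)

theorem IsOrthogonalPolynomials.last_ne_zero (hP : IsOrthogonalPolynomials Γ μ N P) :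
    P (Fin.last N) ≠ 0 := fun h => by
  have := hP.degree_eq (Fin.last N)
  simp [h] at this

variable [IsFiniteMeasure μ]

theorem integrableOn_polynomial_eval (hΓ : IsCompact Γ) (q : ℝ[X]) :
    IntegrableOn (fun x => q.eval x) Γ μ :=
  q.continuous.continuousOn.integrableOn_compact hΓ

/-- Taking `a = 1` gives positive definiteness of the form; a general `a` serves to exclude divisors
of constant sign. -/
theorem integral_mul_sq_pos (hΓ : IsCompact Γ) (hμ : PolynomialDetermining Γ μ) {a g : ℝ[X]}
    (ha : ∀ x ∈ Γ, 0 ≤ a.eval x) (ha0 : a ≠ 0) (hg0 : g ≠ 0) :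
    0 < ∫ x in Γ, (a * g ^ 2).eval x ∂μ := by
  have hnn : 0 ≤ᵐ[μ.restrict Γ] fun x => (a * g ^ 2).eval x := by
    filter_upwards [ae_restrict_mem hΓ.measurableSet] with x hx
    simp only [eval_mul, eval_pow, Pi.zero_apply]
    exact mul_nonneg (ha x hx) (sq_nonneg _)
  refine lt_of_le_of_ne (integral_nonneg_of_ae hnn) fun h => ?_
  have h0 := (integral_eq_zero_iff_of_nonneg_ae hnn
    (integrableOn_polynomial_eval hΓ (a * g ^ 2))).1 h.symm
  exact mul_ne_zero ha0 (pow_ne_zero 2 hg0) (hμ _ h0)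

/-- The bilinear form `(p, q) ↦ ∫ p q dμ` on real polynomials. -/
noncomputable def polynomialInner (hΓ : IsCompact Γ) (μ : Measure ℝ) [IsFiniteMeasure μ] :
    ℝ[X] →ₗ[ℝ] ℝ[X] →ₗ[ℝ] ℝ :=
  LinearMap.mk₂ ℝ (fun p q => ∫ x in Γ, (p * q).eval x ∂μ)
    (fun p p' q => by
      simp only [add_mul, eval_add]
      exact integral_add (integrableOn_polynomial_eval hΓ _) (integrableOn_polynomial_eval hΓ _))
    (fun c p q => by
      simp only [smul_mul_assoc, eval_smul]
      exact integral_smul _ _)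
    (fun p q q' => by
      simp only [mul_add, eval_add]
      exact integral_add (integrableOn_polynomial_eval hΓ _) (integrableOn_polynomial_eval hΓ _))
    (fun c p q => by
      simp only [mul_smul_comm, eval_smul]
      exact integral_smul _ _)

theorem polynomialInner_apply (hΓ : IsCompact Γ) (p q : ℝ[X]) :
    polynomialInner hΓ μ p q = ∫ x in Γ, p.eval x * q.eval x ∂μ := by
  simp [polynomialInner]

theorem polynomialInner_mul_sq_pos (hΓ : IsCompact Γ) (hμ : PolynomialDetermining Γ μ)
    {a g : ℝ[X]} (ha : ∀ x ∈ Γ, 0 ≤ a.eval x) (ha0 : a ≠ 0) (hg0 : g ≠ 0) :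
    0 < polynomialInner hΓ μ (a * g) g := by
  have := integral_mul_sq_pos hΓ hμ ha ha0 hg0
  rw [polynomialInner_apply]
  refine this.trans_eq (integral_congr_ae (.of_forall fun x => ?_))
  simp only [eval_mul, eval_pow]
  ring

theorem exists_degree_eq_forall_polynomialInner_eq_zero (hΓ : IsCompact Γ)
    (hμ : PolynomialDetermining Γ μ) (n : ℕ) :
    ∃ P : ℝ[X], P.degree = n ∧ ∀ q : ℝ[X], q.degree < n → polynomialInner hΓ μ P q = 0 := by
  set W := degreeLT ℝ n
  set B : W →ₗ[ℝ] W →ₗ[ℝ] ℝ := (polynomialInner hΓ μ).domRestrict₁₂ W W with hB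
  have : FiniteDimensional ℝ W := (degreeLTEquiv ℝ n).symm.finiteDimensional
  have hinj : Function.Injective B := by
    rw [← LinearMap.ker_eq_bot, LinearMap.ker_eq_bot']
    intro g hg
    by_contra hg0
    have h1 := polynomialInner_mul_sq_pos (a := 1) (g := (g : ℝ[X])) hΓ hμ (by simp) one_ne_zero
      (by simpa using hg0)
    have h2 : polynomialInner hΓ μ g g = B g g := rfl
    rw [one_mul, h2, hg] at h1
    simp at h1
  -- Definiteness and finite dimension make the form represent every functional on `W`; subtracting
  -- the representative `r` of `X ^ n` is the orthogonal projection.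
  have hsurj : Function.Surjective B :=
    (LinearMap.injective_iff_surjective_of_finrank_eq_finrank
      (Subspace.dual_finrank_eq (K := ℝ) (V := W)).symm).1 hinj
  obtain ⟨r, hr⟩ := hsurj ((polynomialInner hΓ μ (X ^ n)).domRestrict W)
  have hrdeg : (r : ℝ[X]).degree < n := mem_degreeLT.1 r.2
  refine ⟨X ^ n - (r : ℝ[X]), ?_, fun q hq => ?_⟩
  · rw [degree_sub_eq_left_of_degree_lt (by rwa [degree_X_pow]), degree_X_pow]
  · have := LinearMap.congr_fun hr ⟨q, mem_degreeLT.2 hq⟩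
    rw [map_sub, LinearMap.sub_apply, sub_eq_zero]
    exact this.symm

theorem exists_isOrthogonalPolynomials (hΓ : IsCompact Γ) (hμ : PolynomialDetermining Γ μ)
    (N : ℕ) : ∃ P, IsOrthogonalPolynomials Γ μ N P := by
  choose P hdeg horth using exists_degree_eq_forall_polynomialInner_eq_zero hΓ hμ
  refine ⟨fun j => P j, fun j => hdeg j, fun i j hij => ?_⟩
  rcases lt_or_gt_of_ne hij with h | h
  · have := horth j (P i) (by rw [hdeg]; exact_mod_cast h)
    rw [polynomialInner_apply] at this
    simpa only [mul_comm] using this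
  · have := horth i (P j) (by rw [hdeg]; exact_mod_cast h)
    rwa [polynomialInner_apply] at this

/-- Exact degrees make the lower members of the family span all polynomials of degree below `N`; the
induction strips off leading coefficients. -/
theorem IsOrthogonalPolynomials.polynomialInner_eq_zero (hP : IsOrthogonalPolynomials Γ μ N P)
    (hΓ : IsCompact Γ) {q : ℝ[X]} (hq : q.degree < N) :
    polynomialInner hΓ μ (P (Fin.last N)) q = 0 := by
  suffices H : ∀ n ≤ N, ∀ q : ℝ[X], q.degree < n →
      polynomialInner hΓ μ (P (Fin.last N)) q = 0 from H N le_rfl q hq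
  intro n
  induction n with
  | zero =>
    intro _ q hq
    have : q = 0 := by rwa [Nat.cast_zero, Nat.WithBot.lt_zero_iff, degree_eq_bot] at hq
    simp [this]
  | succ n ih =>
    intro hn q hq
    let j : Fin (N + 1) := ⟨n, by omega⟩
    have hjdeg : (P j).degree = n := hP.degree_eq j
    have hlc : (P j).coeff n ≠ 0 := coeff_ne_zero_of_eq_degree hjdeg
    have hlow : (q - (q.coeff n / (P j).coeff n) • P j).degree < n := by
      rw [degree_lt_iff_coeff_zero] at hq ⊢
      intro k hk
      rcases hk.eq_or_lt with rfl | hk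
      · simp [hlc]
      · have : (P j).coeff k = 0 := coeff_eq_zero_of_degree_lt (by rw [hjdeg]; exact_mod_cast hk)
        simp [this, hq k hk]
    have h1 := ih (by omega) _ hlow
    have h2 : polynomialInner hΓ μ (P (Fin.last N)) (P j) = 0 := by
      rw [polynomialInner_apply]
      exact hP.orthogonal _ _ fun h => by
        have := congrArg Fin.val h
        simp only [Fin.val_last, j] at this
        omega
    rwa [map_sub, map_smul, h2, smul_zero, sub_zero] at h1

/-- An orthogonal polynomial has no non-constant divisor which is non-negative on the support. -/
theorem IsOrthogonalPolynomials.not_dvd_last (hP : IsOrthogonalPolynomials Γ μ N P)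
    (hΓ : IsCompact Γ) (hμ : PolynomialDetermining Γ μ) {a : ℝ[X]} (hdeg : 0 < a.natDegree)
    (ha : ∀ x ∈ Γ, 0 ≤ a.eval x) : ¬ a ∣ P (Fin.last N) := by
  rintro ⟨g, hg⟩
  have h0 := hP.last_ne_zero
  have ha0 : a ≠ 0 := by rintro rfl; simp at hdeg
  have hg0 : g ≠ 0 := by rintro rfl; simp [hg] at h0
  have hN := hP.natDegree_last
  rw [hg, natDegree_mul ha0 hg0] at hN
  have hgN : g.degree < N := (natDegree_lt_iff_degree_lt hg0).1 (by omega)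
  -- The cofactor `g` has degree below `N`, so `∫ a g²` is both positive and zero.
  have h1 := polynomialInner_mul_sq_pos hΓ hμ ha ha0 hg0
  rw [← hg, hP.polynomialInner_eq_zero hΓ hgN] at h1
  exact lt_irrefl _ h1

/-- A root outside the interval gives a linear factor of constant sign on `Γ`. -/
theorem IsOrthogonalPolynomials.quadNodes_subset (hP : IsOrthogonalPolynomials Γ μ N P)
    (hΓ : IsCompact Γ) (hμ : PolynomialDetermining Γ μ) {a b : ℝ} (hab : Γ ⊆ Set.Icc a b) :
    (quadNodes (P (Fin.last N)) : Set ℝ) ⊆ Set.Icc a b := by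
  intro x hx
  have hroot : X - C x ∣ P (Fin.last N) := by
    rw [dvd_iff_isRoot]
    exact isRoot_of_mem_roots (Multiset.mem_toFinset.1 hx)
  constructor
  · by_contra! h
    refine hP.not_dvd_last hΓ hμ (by simp) (fun y hy => ?_) hroot
    simp only [eval_sub, eval_X, eval_C]
    linarith [(hab hy).1]
  · by_contra! h
    refine hP.not_dvd_last hΓ hμ (a := -(X - C x)) (by rw [natDegree_neg]; simp) (fun y hy => ?_)
      (neg_dvd.2 hroot)
    simp only [eval_neg, eval_sub, eval_X, eval_C]
    linarith [(hab hy).2]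

/-- A multiple root would give a square divisor, and a non-real root `z` the divisor `|x - z|²`;
both are non-negative. -/
theorem IsOrthogonalPolynomials.card_quadNodes (hP : IsOrthogonalPolynomials Γ μ N P)
    (hΓ : IsCompact Γ) (hμ : PolynomialDetermining Γ μ) :
    (quadNodes (P (Fin.last N))).card = N := by
  have hnodup : (P (Fin.last N)).roots.Nodup := by
    rw [Multiset.nodup_iff_count_le_one]
    intro x
    by_contra! h
    rw [count_roots] at h
    refine hP.not_dvd_last hΓ hμ (a := (X - C x) ^ 2) (by simp) (fun y _ => ?_)
      ((le_rootMultiplicity_iff hP.last_ne_zero).1 h)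
    simp only [eval_pow]
    positivity
  rw [quadNodes, Multiset.toFinset_card_of_nodup hnodup]
  obtain ⟨q, hq, hcard, hroots⟩ := exists_prod_multiset_X_sub_C_mul (P (Fin.last N))
  rw [hP.natDegree_last] at hcard
  suffices q.natDegree = 0 by omega
  by_contra hq0
  obtain ⟨z, hz⟩ := IsAlgClosed.exists_aeval_eq_zero ℂ q (natDegree_pos_iff_degree_pos.1
    (Nat.pos_of_ne_zero hq0)).ne'
  have hqne : q ≠ 0 := by rintro rfl; simp at hq0
  have him : z.im ≠ 0 := by
    intro him
    have hzr : z = algebraMap ℝ ℂ z.re := Complex.ext (by simp) (by simp [him])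
    rw [hzr, aeval_algebraMap_apply, map_eq_zero_iff _ (algebraMap ℝ ℂ).injective] at hz
    have : z.re ∈ q.roots := (mem_roots hqne).2 hz
    simp [hroots] at this
  refine hP.not_dvd_last hΓ hμ (a := X ^ 2 - C (2 * z.re) * X + C (‖z‖ ^ 2)) ?_ (fun y _ => ?_)
    ((quadratic_dvd_of_aeval_eq_zero_im_ne_zero q hz him).trans ⟨_, (mul_comm _ _).trans hq |>.symm⟩)
  · have : (X ^ 2 - C (2 * z.re) * X + C (‖z‖ ^ 2)).natDegree = 2 := by compute_degree!
    omega
  · simp only [eval_add, eval_sub, eval_pow, eval_X, eval_mul, eval_C, Complex.sq_norm,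
      Complex.normSq_apply]
    nlinarith [sq_nonneg (y - z.re), sq_nonneg z.im]

/-- The Gauss rule is exact on polynomials of degree less than `2 * N`. -/
theorem IsOrthogonalPolynomials.integral_eq_gaussRule (hP : IsOrthogonalPolynomials Γ μ N P)
    (hΓ : IsCompact Γ) (hμ : PolynomialDetermining Γ μ) {q : ℝ[X]}
    (hq : q.degree < (2 * N : ℕ)) :
    ∫ x in Γ, q.eval x ∂μ = gaussRule Γ μ N P fun x => q.eval x := by
  set p := P (Fin.last N) with hp
  have hcard := hP.card_quadNodes hΓ hμ
  have hp0 := hP.last_ne_zero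
  have hpdeg : p.degree = N := hP.degree_eq _
  -- In `q = p * (q / p) + q % p` the product integrates to zero by orthogonality and vanishes at
  -- the nodes; the remainder equals its interpolant.
  have hmod : (q % p).degree < N := hpdeg ▸ EuclideanDomain.mod_lt q hp0
  have hdiv : (q / p).degree < N := by
    by_cases hqp : p.degree ≤ q.degree
    · have h := degree_add_div hp0 hqp
      have hne : q / p ≠ 0 := fun h0 => by
        rw [Polynomial.div_eq_zero_iff hp0] at h0
        exact absurd h0 (not_lt.2 hqp)
      have hq0 : q ≠ 0 := by rintro rfl; simp at hne
      rw [hpdeg, degree_eq_natDegree hne, degree_eq_natDegree hq0] at h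
      rw [degree_eq_natDegree hq0] at hq
      rw [degree_eq_natDegree hne]
      have h' : N + (q / p).natDegree = q.natDegree := by exact_mod_cast h
      have hq' : q.natDegree < 2 * N := by exact_mod_cast hq
      exact_mod_cast (by omega : (q / p).natDegree < N)
    · rw [(Polynomial.div_eq_zero_iff hp0).2 (not_le.1 hqp), degree_zero]
      exact WithBot.bot_lt_coe _
  have hdecomp : ∀ x, q.eval x = p.eval x * (q / p).eval x + (q % p).eval x := fun x => by
    conv_lhs => rw [← EuclideanDomain.div_add_mod q p]
    rw [eval_add, eval_mul]
  have hmodint : (q % p) = Lagrange.interpolate (quadNodes p) id fun x => (q % p).eval x :=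
    Lagrange.eq_interpolate Function.injective_id.injOn (by rw [hcard]; exact hmod)
  have hI : ∫ x in Γ, q.eval x ∂μ = ∫ x in Γ, (q % p).eval x ∂μ := by
    have h1 : IntegrableOn (fun x => p.eval x * (q / p).eval x) Γ μ := by
      simpa only [eval_mul] using integrableOn_polynomial_eval hΓ (p * (q / p))
    have h0 := hP.polynomialInner_eq_zero hΓ hdiv
    rw [polynomialInner_apply] at h0
    simp only [hdecomp]
    rw [integral_add h1 (integrableOn_polynomial_eval hΓ _), h0, zero_add]
  rw [hI, gaussRule, hmodint]
  simp only [Lagrange.interpolate_apply, eval_finsetSum, eval_mul, eval_C]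
  rw [integral_finsetSum _ fun x _ => (integrableOn_polynomial_eval hΓ _).const_mul _]
  refine Finset.sum_congr rfl fun x hx => ?_
  have hroot : p.eval x = 0 := isRoot_of_mem_roots (Multiset.mem_toFinset.1 hx)
  rw [integral_const_mul, hdecomp x, hroot, zero_mul, zero_add, quadWeight, smul_eq_mul, mul_comm]

/-- The squared Lagrange basis polynomial has degree `2 * N - 2`, so exactness identifies the weight
with its integral. -/
theorem IsOrthogonalPolynomials.quadWeight_nonneg (hP : IsOrthogonalPolynomials Γ μ N P)
    (hΓ : IsCompact Γ) (hμ : PolynomialDetermining Γ μ) {x : ℝ}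
    (hx : x ∈ quadNodes (P (Fin.last N))) : 0 ≤ quadWeight Γ μ (P (Fin.last N)) x := by
  set s := quadNodes (P (Fin.last N)) with hs
  have hcard : s.card = N := hP.card_quadNodes hΓ hμ
  have hpos : 0 < s.card := Finset.card_pos.2 ⟨x, hx⟩
  have hdeg : ((Lagrange.basis s id x) ^ 2).degree < (2 * N : ℕ) := by
    rw [degree_pow, Lagrange.degree_basis Function.injective_id.injOn hx, hcard, nsmul_eq_mul]
    exact_mod_cast (by omega : 2 * (N - 1) < 2 * N)
  have h := hP.integral_eq_gaussRule hΓ hμ hdeg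
  rw [gaussRule, Finset.sum_eq_single x] at h
  · have h1 : (Lagrange.basis s id x).eval x = 1 :=
      Lagrange.eval_basis_self (v := id) Function.injective_id.injOn hx
    rw [eval_pow, h1, one_pow, smul_eq_mul, mul_one] at h
    rw [← h]
    exact integral_nonneg fun y => by simp only [eval_pow]; positivity
  · intro y hy hyx
    have : (Lagrange.basis s id x).eval y = 0 := Lagrange.eval_basis_of_ne (v := id) hyx.symm hy
    rw [eval_pow, this]
    simp
  · exact fun h => absurd hx h

theorem IsOrthogonalPolynomials.sum_quadWeight (hP : IsOrthogonalPolynomials Γ μ N P)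
    (hΓ : IsCompact Γ) (hμ : PolynomialDetermining Γ μ) (hN : 1 ≤ N) :
    ∑ x ∈ quadNodes (P (Fin.last N)), quadWeight Γ μ (P (Fin.last N)) x = μ.real Γ := by
  have h := hP.integral_eq_gaussRule hΓ hμ (q := 1)
    (by rw [degree_one]; exact_mod_cast (by omega : 0 < 2 * N))
  simpa [gaussRule] using h.symm

theorem IsOrthogonalPolynomials.abs_integral_sub_gaussRule_le
    (hP : IsOrthogonalPolynomials Γ μ N P) (hΓ : IsCompact Γ) (hμ : PolynomialDetermining Γ μ)
    (hN : 1 ≤ N) {a b : ℝ} (hab : Γ ⊆ Set.Icc a b) {f : ℝ → ℝ} (hf : IntegrableOn f Γ μ)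
    {q : ℝ[X]} (hq : q.degree < (2 * N : ℕ)) {ε : ℝ}
    (hfq : ∀ x ∈ Set.Icc a b, |f x - q.eval x| ≤ ε) :
    |(∫ x in Γ, f x ∂μ) - gaussRule Γ μ N P f| ≤ 2 * μ.real Γ * ε := by
  have hI : |∫ x in Γ, (f x - q.eval x) ∂μ| ≤ ε * μ.real Γ :=
    norm_setIntegral_le_of_norm_le_const (f := fun x => f x - q.eval x) (measure_lt_top μ Γ)
      fun x hx => hfq x (hab hx)
  rw [integral_sub hf (integrableOn_polynomial_eval hΓ q), hP.integral_eq_gaussRule hΓ hμ hq] at hI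
  have hQ : |gaussRule Γ μ N P (fun x => q.eval x) - gaussRule Γ μ N P f| ≤ μ.real Γ * ε := by
    rw [gaussRule, gaussRule, ← Finset.sum_sub_distrib, ← hP.sum_quadWeight hΓ hμ hN,
      Finset.sum_mul]
    refine (Finset.abs_sum_le_sum_abs _ _).trans (Finset.sum_le_sum fun x hx => ?_)
    rw [← smul_sub, smul_eq_mul, abs_mul, abs_of_nonneg (hP.quadWeight_nonneg hΓ hμ hx), abs_sub_comm]
    exact mul_le_mul_of_nonneg_left (hfq x (hP.quadNodes_subset hΓ hμ hab hx))
      (hP.quadWeight_nonneg hΓ hμ hx)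
  calc _ ≤ |(∫ x in Γ, f x ∂μ) - gaussRule Γ μ N P fun x => q.eval x| +
        |gaussRule Γ μ N P (fun x => q.eval x) - gaussRule Γ μ N P f| := abs_sub_le _ _ _
    _ ≤ ε * μ.real Γ + μ.real Γ * ε := add_le_add hI hQ
    _ = _ := by ring

/-- Gauss quadrature converges exponentially for functions that are analytic on an interval
containing the support of the measure. -/
theorem exists_abs_integral_sub_gaussRule_le_exp (hΓ : IsCompact Γ)
    (hμ : PolynomialDetermining Γ μ) {a b : ℝ} (hab : Γ ⊆ Set.Icc a b) {f : ℝ → ℝ}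
    (hf : AnalyticOnNhd ℝ f (Set.Icc a b)) :
    ∃ C c : ℝ, 0 ≤ C ∧ 0 < c ∧ ∀ N : ℕ, 1 ≤ N → ∀ P, IsOrthogonalPolynomials Γ μ N P →
      |(∫ x in Γ, f x ∂μ) - gaussRule Γ μ N P f| ≤ C * Real.exp (-c * N) := by
  obtain ⟨A, K, hA, H⟩ := hf.exists_polynomial_approx
  -- The approximation order is `⌊N / (K + 1)⌋`, giving degree at most `N < 2 * N`; the factor `2`
  -- next to `A` pays for the floor.
  refine ⟨2 * μ.real Γ * (A * 2), Real.log 2 / (K + 1), by positivity,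
    div_pos (Real.log_pos one_lt_two) (by positivity), fun N hN P hP => ?_⟩
  obtain ⟨q, hq, hfq⟩ := H (N / (K + 1))
  have hqN : q.degree < (2 * N : ℕ) := by
    refine degree_le_natDegree.trans_lt ?_
    have := Nat.mul_div_le N (K + 1)
    exact_mod_cast (by omega : q.natDegree < 2 * N)
  refine (hP.abs_integral_sub_gaussRule_le hΓ hμ hN hab
    ((hf.continuousOn.mono hab).integrableOn_compact hΓ) hqN hfq).trans ?_
  rw [mul_assoc (2 * μ.real Γ), mul_assoc A]
  gcongr
  have hfloor : (N : ℝ) / (K + 1) ≤ (N / (K + 1) : ℕ) + 1 := by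
    rw [div_le_iff₀ (by positivity)]
    have := Nat.lt_mul_div_succ N (Nat.succ_pos K)
    have h' : N ≤ (N / (K + 1) + 1) * (K + 1) := by rw [mul_comm]; exact this.le
    exact_mod_cast h'
  have e1 : (1 / 2 : ℝ) ^ (N / (K + 1)) =
      2 * Real.exp (-(Real.log 2 * ((N / (K + 1) : ℕ) + 1))) := by
    have : (1 / 2 : ℝ) = Real.exp (-Real.log 2) := by
      rw [Real.exp_neg, Real.exp_log two_pos, one_div]
    rw [mul_add, neg_add, Real.exp_add, mul_one, ← this, this, ← Real.exp_nat_mul, ← this]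
    rw [show ((N / (K + 1) : ℕ) : ℝ) * -Real.log 2 = -(Real.log 2 * (N / (K + 1) : ℕ)) by ring]
    ring
  rw [e1]
  gcongr
  have := mul_le_mul_of_nonneg_left hfloor (Real.log_pos one_lt_two).le
  calc -(Real.log 2 * ((N / (K + 1) : ℕ) + 1)) ≤ -(Real.log 2 * (N / (K + 1))) := neg_le_neg this
    _ = _ := by ring

end Quadrature

/-! ### Self-similar measures under the open set condition -/

theorem IsCompact.exists_convexHull_eq_Icc {Γ : Set ℝ} (hΓ : IsCompact Γ) (hne : Γ.Nonempty) :
    ∃ a b : ℝ, convexHull ℝ Γ = Set.Icc a b := by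
  obtain ⟨a, ha⟩ := hΓ.exists_isLeast hne
  obtain ⟨b, hb⟩ := hΓ.exists_isGreatest hne
  refine ⟨a, b, Set.Subset.antisymm
    (convexHull_min (fun x hx => ⟨ha.2 hx, hb.2 hx⟩) (convex_Icc a b)) ?_⟩
  rw [← segment_eq_Icc (ha.2 hb.1)]
  exact segment_subset_convexHull ha.1 hb.1

namespace SimilarityIFS

variable {M : ℕ} (S : SimilarityIFS M)

theorem injective_map (m : Fin M) : Function.Injective (S.map m) := fun x y h => by
  have := S.abs_map_sub_map m x y
  rw [h, sub_self, abs_zero, eq_comm, mul_eq_zero, abs_eq_zero, sub_eq_zero] at this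
  exact this.resolve_left (S.ratio_pos m).ne'

theorem exists_map_eq_of_fixed {m : Fin M} {x₀ : ℝ} (h : S.map m x₀ = x₀) :
    ∃ c : ℝ, ∀ x, S.map m x = x₀ + c * (x - x₀) := by
  have hsq : ∀ x y, (S.map m x - S.map m y) ^ 2 = S.ratio m ^ 2 * (x - y) ^ 2 := fun x y => by
    rw [← sq_abs, S.abs_map_sub_map, mul_pow, sq_abs]
  set u := S.map m (x₀ + 1) - x₀ with hu
  have hprod : ∀ x, (S.map m x - x₀) * u = S.ratio m ^ 2 * (x - x₀) := fun x => by
    have h1 := hsq x x₀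
    have h2 := hsq (x₀ + 1) x₀
    have h3 := hsq x (x₀ + 1)
    rw [h] at h1 h2
    have h3' : S.map m (x₀ + 1) = u + x₀ := by rw [hu]; ring
    rw [h3'] at h2 h3
    -- Polarisation: squared distances determine the product of displacements from `x₀`, which makes
    -- the map affine.
    linear_combination (h1 + h2 - h3) / 2
  have hu0 : u ≠ 0 := fun h0 => by
    have := hprod (x₀ + 1)
    rw [h0] at this
    have hr := pow_pos (S.ratio_pos m) 2
    linarith
  refine ⟨S.ratio m ^ 2 / u, fun x => ?_⟩
  have := hprod x
  field_simp
  linear_combination this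

/-- Under the open set condition two distinct maps do not have a common fixed point. -/
theorem OpenSetCondition.eq_of_fixed {S : SimilarityIFS M} (hS : S.OpenSetCondition)
    {m m' : Fin M} {x₀ : ℝ} (h : S.map m x₀ = x₀) (h' : S.map m' x₀ = x₀) : m = m' := by
  obtain ⟨O, ⟨x, hx⟩, -, -, hsub, hdisj⟩ := hS
  obtain ⟨c, hc⟩ := S.exists_map_eq_of_fixed h
  obtain ⟨c', hc'⟩ := S.exists_map_eq_of_fixed h'
  have hmem : ∀ k, S.map k x ∈ O := fun k => hsub (Set.mem_iUnion.2 ⟨k, x, hx, rfl⟩)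
  by_contra hne
  -- Affine maps of the line with the same fixed point commute, so both compositions send `x` to one
  -- point lying in two disjoint images.
  refine Set.disjoint_left.1 (hdisj m m' hne) ⟨_, hmem m', rfl⟩ ⟨_, hmem m, ?_⟩
  simp only [hc, hc']
  ring

variable {S} {Γ : Set ℝ} {p : Fin M → ℝ} {μ : Measure ℝ}

/-- Self-similarity gives the image point at least the mass `p m * μ {x}`. -/
theorem IsSelfSimilarMeasure.measure_singleton_map_ne_zero (hμ : S.IsSelfSimilarMeasure Γ p μ)
    (m : Fin M) {x : ℝ} (hx : μ {x} ≠ 0) : μ {S.map m x} ≠ 0 := by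
  rw [hμ.self_similar _ (measurableSet_singleton _)]
  intro h
  have := (Finset.sum_eq_zero_iff.1 h) m (Finset.mem_univ m)
  rcases mul_eq_zero.1 this with h | h
  · exact absurd (ENNReal.ofReal_eq_zero.1 h) (not_le.2 (hμ.weight_pos m))
  · exact hx (measure_mono_null (by simp) h)

/-- A self-similar measure of an iterated function system that satisfies the open set condition is
not concentrated on a finite set. -/
theorem IsSelfSimilarMeasure.measure_compl_finset_ne_zero (hμ : S.IsSelfSimilarMeasure Γ p μ)
    (hS : S.OpenSetCondition) (F : Finset ℝ) : μ (F : Set ℝ)ᶜ ≠ 0 := by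
  classical
  intro hF
  -- `A` is the set of atoms. Each map sends `A` injectively into itself, hence onto; contraction
  -- then forces diameter zero.
  set A : Finset ℝ := F.filter fun x => μ {x} ≠ 0 with hA
  have hmemA : ∀ x, x ∈ A ↔ μ {x} ≠ 0 := fun x => by
    rw [hA, Finset.mem_filter, and_iff_right_iff_imp]
    intro hx
    by_contra hxF
    exact hx (measure_mono_null (by simpa using hxF) hF)
  have hAne : A.Nonempty := by
    rw [Finset.nonempty_iff_ne_empty]
    intro hA0
    refine hμ.ne_zero (Measure.measure_univ_eq_zero.1 ?_)
    have hF0 : μ (F : Set ℝ) = 0 := by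
      rw [← Set.biUnion_of_singleton (F : Set ℝ)]
      refine (measure_biUnion_null_iff F.countable_toSet).2 fun x _ => ?_
      by_contra hx
      have := (hmemA x).2 hx
      simp [hA0] at this
    rw [← Set.union_compl_self (F : Set ℝ)]
    exact measure_union_null hF0 hF
  have himg : ∀ m, A.image (S.map m) = A := fun m =>
    Finset.eq_of_subset_of_card_le (fun y hy => by
      obtain ⟨x, hx, rfl⟩ := Finset.mem_image.1 hy
      exact (hmemA _).2 (hμ.measure_singleton_map_ne_zero m ((hmemA x).1 hx)))
      (Finset.card_image_of_injective _ (S.injective_map m)).ge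
  let m₀ : Fin M := ⟨0, by have := S.two_le; omega⟩
  let m₁ : Fin M := ⟨1, by have := S.two_le; omega⟩
  obtain ⟨⟨x, y⟩, hxy, hmax⟩ := (A ×ˢ A).exists_max_image (fun z => |z.1 - z.2|)
    (hAne.product hAne)
  have hdist : |x - y| = 0 := by
    obtain ⟨hx, hy⟩ := Finset.mem_product.1 hxy
    rw [← himg m₀] at hx hy
    obtain ⟨x', hx', rfl⟩ := Finset.mem_image.1 hx
    obtain ⟨y', hy', rfl⟩ := Finset.mem_image.1 hy
    have h1 := hmax (x', y') (Finset.mem_product.2 ⟨hx', hy'⟩)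
    simp only at h1
    have h2 := S.abs_map_sub_map m₀ x' y'
    have h3 := S.ratio_lt_one m₀
    have h4 := S.ratio_pos m₀
    have h5 := abs_nonneg (x' - y')
    nlinarith
  obtain ⟨x₀, hx₀⟩ := hAne
  have hfix : ∀ m, S.map m x₀ = x₀ := fun m => by
    have hm : S.map m x₀ ∈ A := by
      rw [← himg m]
      exact Finset.mem_image_of_mem _ hx₀
    have := hmax (S.map m x₀, x₀) (Finset.mem_product.2 ⟨hm, hx₀⟩)
    simp only [hdist] at this
    exact sub_eq_zero.1 (abs_eq_zero.1 (le_antisymm this (abs_nonneg _)))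
  have := hS.eq_of_fixed (hfix m₀) (hfix m₁)
  simp [m₀, m₁] at this

theorem IsSelfSimilarMeasure.polynomialDetermining (hμ : S.IsSelfSimilarMeasure Γ p μ)
    (hS : S.OpenSetCondition) : PolynomialDetermining Γ μ := by
  intro q hq
  rw [Measure.restrict_eq_self_of_ae_mem (mem_ae_iff.2 hμ.supported), ae_iff] at hq
  by_contra hq0
  refine hμ.measure_compl_finset_ne_zero hS q.roots.toFinset (measure_mono_null ?_ hq)
  intro x hx h0
  exact hx (by simpa [hq0] using h0)

end SimilarityIFS

/-! ### Reduction to real-valued integrands, and the main theorem -/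

theorem RCLike.norm_le_abs_re_add_abs_im {𝕜 : Type*} [RCLike 𝕜] (z : 𝕜) :
    ‖z‖ ≤ |RCLike.re z| + |RCLike.im z| := by
  refine abs_le_of_sq_le_sq' ?_ (by positivity) |>.2
  rw [RCLike.norm_sq_eq_def, add_sq, sq_abs, sq_abs]
  nlinarith [mul_nonneg (abs_nonneg (RCLike.re z)) (abs_nonneg (RCLike.im z))]

section RCLike

variable {𝕜 : Type*} [RCLike 𝕜] {Γ : Set ℝ} {μ : Measure ℝ} {f : ℝ → 𝕜}

theorem re_integral_sub_gaussRule (hf : IntegrableOn f Γ μ) (N : ℕ) (P : Fin (N + 1) → ℝ[X]) :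
    RCLike.re ((∫ x in Γ, f x ∂μ) - gaussRule Γ μ N P f) =
      (∫ x in Γ, RCLike.re (f x) ∂μ) - gaussRule Γ μ N P fun x => RCLike.re (f x) := by
  rw [map_sub, ← integral_re hf]
  simp [gaussRule, RCLike.smul_re]

theorem im_integral_sub_gaussRule (hf : IntegrableOn f Γ μ) (N : ℕ) (P : Fin (N + 1) → ℝ[X]) :
    RCLike.im ((∫ x in Γ, f x ∂μ) - gaussRule Γ μ N P f) =
      (∫ x in Γ, RCLike.im (f x) ∂μ) - gaussRule Γ μ N P fun x => RCLike.im (f x) := by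
  rw [map_sub, ← integral_im hf]
  simp [gaussRule, RCLike.smul_im]

end RCLike

theorem theorem6p1 {𝕜 : Type*} [RCLike 𝕜] {M : ℕ} (S : SimilarityIFS M)
    (hS : S.OpenSetCondition) (Γ : Set ℝ) (hΓ : S.IsAttractor Γ)
    (p : Fin M → ℝ) (μ : Measure ℝ) (hμ : S.IsSelfSimilarMeasure Γ p μ)
    (f : ℝ → 𝕜) (U : Set ℝ) (hU : IsOpen U) (hUΓ : convexHull ℝ Γ ⊆ U)
    (hf : AnalyticOnNhd ℝ f U) :
    -- the integral and the `N`-point Gauss rules are well defined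
    IntegrableOn f Γ μ ∧
    (∀ N : ℕ, 1 ≤ N → ∃ P, IsOrthogonalPolynomials Γ μ N P) ∧
    (∀ N : ℕ, 1 ≤ N → ∀ P, IsOrthogonalPolynomials Γ μ N P →
      (quadNodes (P (Fin.last N))).card = N ∧
      (quadNodes (P (Fin.last N)) : Set ℝ) ⊆ convexHull ℝ Γ) ∧
    -- the Gauss rules converge exponentially
    ∃ C c : ℝ, 0 < C ∧ 0 < c ∧ ∀ N : ℕ, 1 ≤ N → ∀ P, IsOrthogonalPolynomials Γ μ N P →
      ‖(∫ x in Γ, f x ∂μ) - gaussRule Γ μ N P f‖ ≤ C * Real.exp (-c * N) := by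
  have := hμ.finite
  have hc := hΓ.isCompact
  have hdet := hμ.polynomialDetermining hS
  obtain ⟨a, b, hhull⟩ := hc.exists_convexHull_eq_Icc hΓ.nonempty
  have hab : Γ ⊆ Set.Icc a b := hhull ▸ subset_convexHull ℝ Γ
  have hfI : AnalyticOnNhd ℝ f (Set.Icc a b) := hf.mono (hhull ▸ hUΓ)
  have hint : IntegrableOn f Γ μ := (hfI.continuousOn.mono hab).integrableOn_compact hc
  refine ⟨hint, fun N _ => exists_isOrthogonalPolynomials hc hdet N, fun N _ P hP =>
    ⟨hP.card_quadNodes hc hdet, hhull ▸ hP.quadNodes_subset hc hdet hab⟩, ?_⟩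
  have hre : AnalyticOnNhd ℝ (fun x => RCLike.re (f x)) (Set.Icc a b) := fun x hx =>
    ((RCLike.reCLM (K := 𝕜)).analyticAt _).comp (hfI x hx)
  have him : AnalyticOnNhd ℝ (fun x => RCLike.im (f x)) (Set.Icc a b) := fun x hx =>
    ((RCLike.imCLM (K := 𝕜)).analyticAt _).comp (hfI x hx)
  obtain ⟨C₁, c₁, hC₁, hc₁, H₁⟩ := exists_abs_integral_sub_gaussRule_le_exp hc hdet hab hre
  obtain ⟨C₂, c₂, hC₂, hc₂, H₂⟩ := exists_abs_integral_sub_gaussRule_le_exp hc hdet hab him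
  -- `C₁` and `C₂` may vanish; the `+ 1` makes the constant strictly positive.
  refine ⟨C₁ + C₂ + 1, min c₁ c₂, by positivity, lt_min hc₁ hc₂, fun N hN P hP => ?_⟩
  have h₁ := H₁ N hN P hP
  have h₂ := H₂ N hN P hP
  rw [← re_integral_sub_gaussRule hint] at h₁
  rw [← im_integral_sub_gaussRule hint] at h₂
  calc _ ≤ _ := RCLike.norm_le_abs_re_add_abs_im _
    _ ≤ C₁ * Real.exp (-c₁ * N) + C₂ * Real.exp (-c₂ * N) := add_le_add h₁ h₂
    _ ≤ C₁ * Real.exp (-min c₁ c₂ * N) + C₂ * Real.exp (-min c₁ c₂ * N) := by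
        gcongr
        · exact min_le_left _ _
        · exact min_le_right _ _
    _ ≤ _ := by
        rw [← add_mul]
        exact mul_le_mul_of_nonneg_right (le_add_of_nonneg_right zero_le_one) (Real.exp_pos _).le
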